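/- Let $F$ be an algebraically closed field of characteristic zero. A 3-Lie algebra over $F$ is a vector space $A$ with an alternating trilinear bracket $[\cdot,\cdot,\cdot]$ such that $$[x_1,x_2,[x_3,x_4,x_5]]=[[x_1,x_2,x_3],x_4,x_5]+[x_3,[x_1,x_2,x_4],x_5]+[x_3,x_4,[x_1,x_2,x_5]]$$ for all $x_1,\dots,x_5\in A$. Let $A^1$ be the subalgebra generated by all brackets $[x,y,z]$ with $x,y,z\in A$, and let $Z(A)=\{x\in A : [x,y,z]=0 \text{ for all } y,z\in A\}$. A 3-pre-Lie algebra is a vector space $A$ with a trilinear product $\{\cdot,\cdot,\cdot\}$ such that, writing $\{x,y,z\}_c=\{x,y,z\}+\{y,z,x\}+\{z,x,y\}$, for all $x_1,\dots,x_5\in A$: 1. $\{x_1,x_2,x_3\}=-\{x_2,x_1,x_3\}$; 2. $\{x_1,x_2,\{x_3,x_4,x_5\}\}=\{\{x_1,x_2,x_3\}_c,x_4,x_5\}+\{x_3,\{x_1,x_2,x_4\}_c,x_5\}+\{x_3,x_4,\{x_1,x_2,x_5\}\}$; 3. $\{\{x_1,x_2,x_3\}_c,x_4,x_5\}=\{x_1,x_2,\{x_3,x_4,x_5\}\}+\{x_2,x_3,\{x_1,x_4,x_5\}\}+\{x_3,x_1,\{x_2,x_4,x_5\}\}$.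 It is compatible with a 3-Lie algebra $(A,[\cdot,\cdot,\cdot])$ on the same vector space if $\{x,y,z\}_c=[x,y,z]$ for all $x,y,z\in A$. **Theorem.** Let $A$ be a 3-Lie algebra over $F$. - If $\dim A=4$, then there is a 3-pre-Lie algebra structure on $A$ compatible with the 3-Lie algebra $A$. - If $\dim A=5$ and either $\dim A^1\le 3$, or $\dim A^1=4$ and $Z(A)\ne 0$, then there is a 3-pre-Lie algebra structure on $A$ compatible with the 3-Lie algebra $A$. -/

import Mathlib

/-- A `3`-Lie algebra structure on the `F`-module `A`: an alternating trilinear bracket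
(that is, a linear map on the third exterior power of `A`) satisfying the Filippov identity. -/
structure ThreeLieAlgebra (F : Type*) (A : Type*) [Field F] [AddCommGroup A] [Module F A] where
  /-- The bracket; `[x, y, z]` is `bracket ![x, y, z]`. -/
  bracket : A [⋀^Fin 3]→ₗ[F] A
  filippov : ∀ x₁ x₂ x₃ x₄ x₅ : A,
    bracket ![x₁, x₂, bracket ![x₃, x₄, x₅]] =
      bracket ![bracket ![x₁, x₂, x₃], x₄, x₅] +
      bracket ![x₃, bracket ![x₁, x₂, x₄], x₅] +
      bracket ![x₃, x₄, bracket ![x₁, x₂, x₅]]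

namespace ThreeLieAlgebra

variable {F A : Type*} [Field F] [AddCommGroup A] [Module F A]

/-- A subspace closed under the bracket. -/
def IsSubalgebra (L : ThreeLieAlgebra F A) (S : Submodule F A) : Prop :=
  ∀ x ∈ S, ∀ y ∈ S, ∀ z ∈ S, L.bracket ![x, y, z] ∈ S

/-- The derived algebra `A¹`: the subalgebra generated by all brackets `[x, y, z]`, i.e. the
smallest subalgebra containing them. -/
def derived (L : ThreeLieAlgebra F A) : Submodule F A :=
  sInf {S : Submodule F A | L.IsSubalgebra S ∧ ∀ x y z : A, L.bracket ![x, y, z] ∈ S}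

/-- The derived algebra is also the linear span of all brackets. -/
theorem derived_eq_span (L : ThreeLieAlgebra F A) :
    L.derived = Submodule.span F {v : A | ∃ x y z : A, L.bracket ![x, y, z] = v} := by
  apply le_antisymm
  · refine sInf_le ⟨?_, ?_⟩
    · intro x _ y _ z _
      exact Submodule.subset_span ⟨x, y, z, rfl⟩
    · intro x y z
      exact Submodule.subset_span ⟨x, y, z, rfl⟩
  · refine le_sInf ?_
    rintro S ⟨_, hS⟩
    refine Submodule.span_le.2 ?_
    rintro _ ⟨x, y, z, rfl⟩
    exact hS x y z

/-- The center `Z(A)`: all `x` with `[x, y, z] = 0` for all `y`, `z`. -/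
def center (L : ThreeLieAlgebra F A) : Submodule F A where
  carrier := {x : A | ∀ y z : A, L.bracket ![x, y, z] = 0}
  add_mem' := by
    intro a b ha hb y z
    rw [L.bracket.map_vecCons_add, ha y z, hb y z, add_zero]
  zero_mem' := by
    intro y z
    exact L.bracket.map_coord_zero 0 rfl
  smul_mem' := by
    intro c x hx y z
    rw [L.bracket.map_vecCons_smul, hx y z, smul_zero]

end ThreeLieAlgebra

/-- The cyclic sum `{x, y, z}_c = {x, y, z} + {y, z, x} + {z, x, y}` of a trilinear product. -/
def cyclicSum {F A : Type*} [Field F] [AddCommGroup A] [Module F A]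
    (p : A →ₗ[F] A →ₗ[F] A →ₗ[F] A) (x y z : A) : A :=
  p x y z + p y z x + p z x y

/-- A `3`-pre-Lie algebra structure on the `F`-module `A`: a trilinear product `{x, y, z}`,
written `prod x y z`, with the three defining identities. -/
structure ThreePreLieAlgebra (F : Type*) (A : Type*) [Field F] [AddCommGroup A] [Module F A] where
  prod : A →ₗ[F] A →ₗ[F] A →ₗ[F] A
  skew : ∀ x₁ x₂ x₃ : A, prod x₁ x₂ x₃ = - prod x₂ x₁ x₃
  prod_prod : ∀ x₁ x₂ x₃ x₄ x₅ : A,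
    prod x₁ x₂ (prod x₃ x₄ x₅) =
      prod (cyclicSum prod x₁ x₂ x₃) x₄ x₅ +
      prod x₃ (cyclicSum prod x₁ x₂ x₄) x₅ +
      prod x₃ x₄ (prod x₁ x₂ x₅)
  cyclicSum_prod : ∀ x₁ x₂ x₃ x₄ x₅ : A,
    prod (cyclicSum prod x₁ x₂ x₃) x₄ x₅ =
      prod x₁ x₂ (prod x₃ x₄ x₅) +
      prod x₂ x₃ (prod x₁ x₄ x₅) +
      prod x₃ x₁ (prod x₂ x₄ x₅)

/-- The `3`-pre-Lie algebra `P` is compatible with the `3`-Lie algebra `L` on the same vector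
space: the cyclic sum of the product of `P` (the sub-adjacent bracket) is the bracket of `L`. -/
def ThreePreLieAlgebra.IsCompatible {F A : Type*} [Field F] [AddCommGroup A] [Module F A]
    (P : ThreePreLieAlgebra F A) (L : ThreeLieAlgebra F A) : Prop :=
  ∀ x y z : A, cyclicSum P.prod x y z = L.bracket ![x, y, z]

/-! An invertible derivation `D` is enough: the Leibniz rule says precisely that `D⁻¹ [x, y, D z]`
has cyclic sum `[x, y, z]`, and conjugation by `D` reduces the remaining identities to Filippov's
(`exists_isCompatible_of_equiv`). Every case constructs such a `D`.

If an abelian hyperplane contains the derived algebra, weights `1` on it and `-1` on a complementary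
line work, since `1 + 1 - 1 = 1`. Such hyperplanes come from the trace form `τ(x, y) = tr [x, y,
·]`, which kills the derived algebra (`traceForm_br`) and has rank at most two
(`traceForm_eq_zero_of_orthogonal`). In dimension four an isotropic hyperplane is abelian. In
dimension five with small derived algebra, a three-dimensional subspace of the radical is abelian,
and a proportionality argument (`exists_smul_add_smul_br_eq_zero`) enlarges it to an abelian
hyperplane.

A four-dimensional derived algebra whose own brackets span it admits a sum of two inner derivations
that is injective on it. A central line outside it is handled by adding a projection; a central line
inside it gets weight `3`. -/

namespace ThreeLieAlgebra

/-! ### Calculus of the bracket, and compatible products from derivations. -/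

variable {F A : Type*} [Field F] [AddCommGroup A] [Module F A]

/-- The bracket as an iterated linear map. -/
def br (L : ThreeLieAlgebra F A) : A →ₗ[F] A →ₗ[F] A →ₗ[F] A :=
  LinearMap.mk₂ F (fun x y =>
    { toFun := fun z => L.bracket ![x, y, z]
      map_add' := fun z w => by
        have e : ∀ t, Function.update ![x, y, 0] 2 t = ![x, y, t] := fun t => by
          ext i; fin_cases i <;> rfl
        simpa only [e] using L.bracket.map_update_add ![x, y, 0] 2 z w
      map_smul' := fun c z => by
        have e : ∀ t, Function.update ![x, y, 0] 2 t = ![x, y, t] := fun t => by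
          ext i; fin_cases i <;> rfl
        simpa only [e, RingHom.id_apply] using L.bracket.map_update_smul ![x, y, 0] 2 c z })
    (fun x x' y => by ext z; exact L.bracket.map_vecCons_add _ _ _)
    (fun c x y => by ext z; exact L.bracket.map_vecCons_smul _ _ _)
    (fun x y y' => by
      ext z
      have e : ∀ t, Function.update ![x, 0, z] 1 t = ![x, t, z] := fun t => by
        ext i; fin_cases i <;> rfl
      have h := L.bracket.map_update_add ![x, 0, z] 1 y y'
      simp only [e] at h
      exact h)
    (fun c x y => by
      ext z
      have e : ∀ t, Function.update ![x, 0, z] 1 t = ![x, t, z] := fun t => by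
        ext i; fin_cases i <;> rfl
      have h := L.bracket.map_update_smul ![x, 0, z] 1 c y
      simp only [e] at h
      exact h)

variable (L : ThreeLieAlgebra F A)

@[simp] theorem br_self_left (x z : A) : L.br x x z = 0 :=
  L.bracket.map_eq_zero_of_eq _ (i := 0) (j := 1) rfl (by decide)

@[simp] theorem br_self_right (x z : A) : L.br x z z = 0 :=
  L.bracket.map_eq_zero_of_eq _ (i := 1) (j := 2) rfl (by decide)

@[simp] theorem br_self_outer (x z : A) : L.br x z x = 0 :=
  L.bracket.map_eq_zero_of_eq _ (i := 0) (j := 2) rfl (by decide)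

theorem br_swap_left (x y z : A) : L.br x y z = - L.br y x z := by
  have h := L.br_self_left (x + y) z
  simp only [map_add, LinearMap.add_apply, br_self_left, zero_add, add_zero] at h
  rw [eq_neg_iff_add_eq_zero, ← h, add_comm]

theorem br_swap_right (x y z : A) : L.br x y z = - L.br x z y := by
  have h := L.br_self_right x (y + z)
  simp only [map_add, LinearMap.add_apply, br_self_right, zero_add, add_zero] at h
  rw [eq_neg_iff_add_eq_zero, ← h, add_comm]

theorem br_rotate (x y z : A) : L.br x y z = L.br y z x := by
  rw [br_swap_left, br_swap_right, neg_neg]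

theorem br_filippov (x₁ x₂ x₃ x₄ x₅ : A) :
    L.br x₁ x₂ (L.br x₃ x₄ x₅) = L.br (L.br x₁ x₂ x₃) x₄ x₅ + L.br x₃ (L.br x₁ x₂ x₄) x₅ +
      L.br x₃ x₄ (L.br x₁ x₂ x₅) :=
  L.filippov x₁ x₂ x₃ x₄ x₅

/-- Up to rotation the left side is `[x₄, y, ·]` applied to a bracket, so Filippov expands it. This
becomes the third 3-pre-Lie identity. -/
theorem br_br_left (x₁ x₂ x₃ x₄ y : A) :
    L.br (L.br x₁ x₂ x₃) x₄ y = L.br x₁ x₂ (L.br x₃ x₄ y) + L.br x₂ x₃ (L.br x₁ x₄ y) +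
      L.br x₃ x₁ (L.br x₂ x₄ y) := by
  rw [L.br_rotate (L.br x₁ x₂ x₃), br_filippov, L.br_rotate x₃ x₄ y, L.br_rotate x₁ x₄ y,
    L.br_rotate x₂ x₄ y, L.br_rotate (L.br x₄ y x₁),
    ← L.br_rotate x₃ x₁ (L.br x₄ y x₂)]
  abel

theorem br_mem_derived (x y z : A) : L.br x y z ∈ L.derived := by
  rw [derived_eq_span]
  exact Submodule.subset_span ⟨x, y, z, rfl⟩

theorem derived_le {S : Submodule F A} (h : ∀ x y z, L.br x y z ∈ S) : L.derived ≤ S := by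
  rw [derived_eq_span, Submodule.span_le]
  rintro _ ⟨x, y, z, rfl⟩
  exact h x y z

/-- A linear endomorphism satisfying the Leibniz rule for the bracket. -/
def IsDerivation (D : A →ₗ[F] A) : Prop :=
  ∀ x y z, D (L.br x y z) = L.br (D x) y z + L.br x (D y) z + L.br x y (D z)

theorem isDerivation_br (x y : A) : L.IsDerivation (L.br x y) :=
  fun _ _ _ => L.br_filippov _ _ _ _ _

variable {L} in
theorem IsDerivation.add {D E : A →ₗ[F] A} (hD : L.IsDerivation D) (hE : L.IsDerivation E) :
    L.IsDerivation (D + E) := fun x y z => by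
  simp only [LinearMap.add_apply, map_add, hD x y z, hE x y z]
  abel

/-- An invertible derivation `D` yields the compatible product `D⁻¹ [x, y, D z]`. -/
theorem exists_isCompatible_of_equiv (D : A ≃ₗ[F] A) (hD : L.IsDerivation (D : A →ₗ[F] A)) :
    ∃ P : ThreePreLieAlgebra F A, P.IsCompatible L := by
  let p : A →ₗ[F] A →ₗ[F] A →ₗ[F] A :=
    LinearMap.mk₂ F (fun x y => (D.symm : A →ₗ[F] A) ∘ₗ L.br x y ∘ₗ (D : A →ₗ[F] A))
      (fun x x' y => by ext; simp) (fun c x y => by ext; simp)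
      (fun x y y' => by ext; simp) (fun c x y => by ext; simp)
  have hp : ∀ x y z, p x y z = D.symm (L.br x y (D z)) := fun _ _ _ => rfl
  -- After applying `D`, the three cyclic terms are the three terms of the Leibniz rule.
  have hc : ∀ x y z, cyclicSum p x y z = L.br x y z := fun x y z => by
    have h := hD x y z
    simp only [LinearEquiv.coe_coe] at h
    rw [cyclicSum, hp, hp, hp, ← map_add, ← map_add, LinearEquiv.symm_apply_eq, h,
      L.br_rotate (D x) y z, ← L.br_rotate z x (D y)]
    abel
  refine ⟨⟨p, fun x y z => ?_, fun x₁ x₂ x₃ x₄ x₅ => ?_, fun x₁ x₂ x₃ x₄ x₅ => ?_⟩,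
    fun x y z => hc x y z⟩
  · rw [hp, hp, L.br_swap_left, map_neg]
  · simp only [hc, hp, LinearEquiv.apply_symm_apply, ← map_add]
    rw [← br_filippov]
  · simp only [hc, hp, LinearEquiv.apply_symm_apply, ← map_add]
    rw [← br_br_left]

theorem exists_isCompatible_of_injective [FiniteDimensional F A] {D : A →ₗ[F] A}
    (hD : L.IsDerivation D) (hinj : Function.Injective D) :
    ∃ P : ThreePreLieAlgebra F A, P.IsCompatible L :=
  L.exists_isCompatible_of_equiv (LinearEquiv.ofInjectiveEndo D hinj) fun x y z => by
    simpa using hD x y z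

theorem br_sub_sub_sub (φ : A →ₗ[F] F) (v x y z : A) :
    L.br (x - φ x • v) (y - φ y • v) (z - φ z • v) =
      L.br x y z - (φ x • L.br v y z + φ y • L.br x v z + φ z • L.br x y v) := by
  simp only [map_sub, map_smul, LinearMap.sub_apply, LinearMap.smul_apply, br_self_left,
    br_self_right, br_self_outer, smul_zero, sub_zero]
  abel

/-- If a hyperplane contains the derived algebra and is abelian, then acting by `1` on the
hyperplane and by `-1` on a complement is a derivation. -/
theorem exists_isCompatible_of_hyperplane [CharZero F] [FiniteDimensional F A] {φ : A →ₗ[F] F}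
    (hφ : φ ≠ 0) (hder : L.derived ≤ LinearMap.ker φ)
    (hab : ∀ x y z, φ x = 0 → φ y = 0 → φ z = 0 → L.br x y z = 0) :
    ∃ P : ThreePreLieAlgebra F A, P.IsCompatible L := by
  obtain ⟨v, hv⟩ : ∃ v, φ v = 1 := LinearMap.surjective hφ 1
  let D : A →ₗ[F] A := LinearMap.id - (2 : F) • φ.smulRight v
  have hDx : ∀ x, D x = x - (2 : F) • φ x • v := fun x => by simp [D]
  refine L.exists_isCompatible_of_injective (D := D) (fun x y z => ?_) ?_
  · have h0 : φ (L.br x y z) = 0 := hder (L.br_mem_derived x y z)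
    -- Projecting to the hyperplane shows that a bracket equals the sum of its `v`-terms; the
    -- Leibniz sum is three brackets minus twice that sum, hence one bracket.
    have h1 := hab (x - φ x • v) (y - φ y • v) (z - φ z • v) (by simp [hv]) (by simp [hv])
      (by simp [hv])
    rw [br_sub_sub_sub, sub_eq_zero] at h1
    simp only [hDx, map_sub, map_smul, LinearMap.sub_apply, LinearMap.smul_apply, h0, zero_smul,
      smul_zero, sub_zero]
    rw [h1]
    module
  · rw [injective_iff_map_eq_zero]
    intro x hx
    have h := congrArg φ hx
    rw [hDx] at h hx
    simp only [map_sub, map_smul, hv, smul_eq_mul, map_zero] at h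
    have h0 : φ x = 0 := by linear_combination -h
    simpa [h0] using hx

end ThreeLieAlgebra

/-! ### Traces of endomorphisms with small range. -/

/-- A basis of a subspace together with coordinate functionals on the whole space, which compute
the trace of endomorphisms with range in the subspace. -/
theorem Submodule.exists_frame {F A : Type*} [Field F] [AddCommGroup A] [Module F A]
    [FiniteDimensional F A] {n : ℕ} {P : Submodule F A} (hP : Module.finrank F P = n) :
    ∃ (e : Fin n → A) (ε : Fin n → A →ₗ[F] F), (∀ i, e i ∈ P) ∧
      (∀ i j, ε i (e j) = if i = j then 1 else 0) ∧ (∀ x ∈ P, x = ∑ i, ε i x • e i) ∧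
      ∀ f : A →ₗ[F] A, (∀ x, f x ∈ P) → LinearMap.trace F A f = ∑ i, ε i (f (e i)) := by
  let b := Module.finBasisOfFinrankEq F P hP
  choose ε hε using fun i => LinearMap.exists_extend (b.coord i)
  have hε' : ∀ i (x : P), ε i x = b.repr x i := fun i x => by
    rw [← b.coord_apply, ← hε]; rfl
  refine ⟨fun i => b i, ε, fun i => (b i).2, fun i j => ?_, fun x hx => ?_, fun f hf => ?_⟩
  · rw [hε', b.repr_self, Finsupp.single_apply]
    simp only [eq_comm]
  · have h := congrArg (Subtype.val) (b.sum_repr ⟨x, hx⟩)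
    simp only [Submodule.coe_sum, Submodule.coe_smul] at h
    rw [← h]
    refine Finset.sum_congr rfl fun i _ => ?_
    rw [h, ← hε']
  · rw [← LinearMap.trace_restrict_eq_of_forall_mem P f hf, LinearMap.trace_eq_matrix_trace F b,
      Matrix.trace]
    refine Finset.sum_congr rfl fun i _ => ?_
    rw [Matrix.diag_apply, LinearMap.toMatrix_apply, ← hε']
    rfl

theorem LinearMap.apply_eq_trace_smul {F A : Type*} [Field F] [AddCommGroup A] [Module F A]
    [FiniteDimensional F A] {f : A →ₗ[F] A} {a : A} (h : ∀ x, f x ∈ Submodule.span F {a}) :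
    f a = LinearMap.trace F A f • a := by
  rcases eq_or_ne a 0 with rfl | ha
  · simp
  obtain ⟨e, ε, he, hee, hx, htr⟩ := Submodule.exists_frame (finrank_span_singleton (K := F) ha)
  obtain ⟨c, hc⟩ := Submodule.mem_span_singleton.1 (he 0)
  have h1 : ε 0 a * c = 1 := by
    have := hee 0 0
    rw [← hc, map_smul] at this
    simpa [mul_comm] using this
  obtain ⟨d, hd⟩ := Submodule.mem_span_singleton.1 (h a)
  rw [htr f h, Fin.sum_univ_one, ← hc, map_smul, map_smul, ← hd, map_smul, smul_eq_mul,
    smul_eq_mul]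
  congr 1
  linear_combination -d * h1

/-! ### The trace form, and dimension four with a proper derived algebra. -/

namespace ThreeLieAlgebra

variable {F A : Type*} [Field F] [AddCommGroup A] [Module F A] (L : ThreeLieAlgebra F A)

/-- The alternating form sending `x, y` to the trace of the inner derivation `[x, y, ·]`. -/
noncomputable def traceForm : A →ₗ[F] A →ₗ[F] F := L.br.compr₂ (LinearMap.trace F A)

theorem traceForm_apply (x y : A) : L.traceForm x y = LinearMap.trace F A (L.br x y) := rfl

theorem traceForm_swap (x y : A) : L.traceForm x y = - L.traceForm y x := by
  rw [traceForm_apply, traceForm_apply, ← map_neg]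
  congr 1
  ext z
  exact L.br_swap_left x y z

@[simp] theorem traceForm_self (x : A) : L.traceForm x x = 0 := by
  have : L.br x x = 0 := by ext z; simp
  rw [traceForm_apply, this, map_zero]

/-- Commutators have trace zero, so the expression is symmetric in `z, w`, while it is alternating
in `x, y, z`. Three rounds of the two transpositions of `y, z, w` return to the start with sign
`-1`. -/
theorem traceForm_br [CharZero F] (x y z w : A) : L.traceForm (L.br x y z) w = 0 := by
  have hs : ∀ x₁ x₂ x₃ x₄, L.traceForm (L.br x₁ x₂ x₃) x₄ = L.traceForm (L.br x₁ x₂ x₄) x₃ := by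
    intro x₁ x₂ x₃ x₄
    have h : L.br (L.br x₁ x₂ x₃) x₄ + L.br x₃ (L.br x₁ x₂ x₄) =
        L.br x₁ x₂ * L.br x₃ x₄ - L.br x₃ x₄ * L.br x₁ x₂ := by
      ext u
      simp [L.br_filippov x₁ x₂ x₃ x₄ u]
    have h' := congrArg (LinearMap.trace F A) h
    rw [map_sub, LinearMap.trace_mul_comm, sub_self, map_add, ← traceForm_apply,
      ← traceForm_apply, L.traceForm_swap x₃] at h'
    linear_combination h'
  have hneg : L.traceForm (L.br x y z) w = - L.traceForm (L.br x y z) w := by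
    conv_lhs => rw [hs, L.br_swap_right, map_neg, LinearMap.neg_apply, hs, L.br_swap_right,
      map_neg, LinearMap.neg_apply, neg_neg, hs, L.br_swap_right, map_neg, LinearMap.neg_apply]
  exact self_eq_neg.1 hneg

theorem traceForm_of_mem_derived [CharZero F] {x : A} (hx : x ∈ L.derived) (y : A) :
    L.traceForm x y = 0 :=
  L.derived_le (S := LinearMap.ker (L.traceForm.flip y)) (fun _ _ _ => L.traceForm_br _ _ _ y) hx

theorem traceForm_of_mem_derived_right [CharZero F] {y : A} (hy : y ∈ L.derived) (x : A) :
    L.traceForm x y = 0 := by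
  rw [traceForm_swap, L.traceForm_of_mem_derived hy, neg_zero]

/-- A three-dimensional subspace that contains the derived algebra and is isotropic for the trace
form is abelian. -/
theorem br_eq_zero_of_isotropic [FiniteDimensional F A] {P : Submodule F A}
    (hP : Module.finrank F P = 3) (hder : L.derived ≤ P)
    (hiso : ∀ x ∈ P, ∀ y ∈ P, L.traceForm x y = 0) :
    ∀ x ∈ P, ∀ y ∈ P, ∀ z ∈ P, L.br x y z = 0 := by
  obtain ⟨e, ε, he, -, hx, htr⟩ := Submodule.exists_frame hP
  have hmem : ∀ x y z, L.br x y z ∈ P := fun x y z => hder (L.br_mem_derived x y z)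
  -- For `i ≠ j` only the third index survives, so the three traces are the coordinates of `[e 0, e
  -- 1, e 2]`.
  have ht : ∀ i j, ∑ k, ε k (L.br (e i) (e j) (e k)) = 0 := fun i j => by
    rw [← htr _ (hmem _ _), ← traceForm_apply, hiso _ (he i) _ (he j)]
  have h2 := ht 0 1
  have h0 := ht 1 2
  have h1 := ht 2 0
  simp only [Fin.sum_univ_three, br_self_outer, br_self_right, map_zero, zero_add,
    add_zero] at h0 h1 h2
  rw [← L.br_rotate] at h0
  rw [L.br_rotate] at h1
  have hc : L.br (e 0) (e 1) (e 2) = 0 := by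
    rw [hx _ (hmem _ _ _), Fin.sum_univ_three, h0, h1, h2]
    simp
  have hc1 : L.br (e 1) (e 2) (e 0) = 0 := by rw [← L.br_rotate, hc]
  have hc2 : L.br (e 2) (e 0) (e 1) = 0 := by rw [L.br_rotate, hc]
  have hc3 : L.br (e 1) (e 0) (e 2) = 0 := by rw [L.br_swap_left, hc, neg_zero]
  have hc4 : L.br (e 2) (e 1) (e 0) = 0 := by rw [L.br_swap_left, hc1, neg_zero]
  have hc5 : L.br (e 0) (e 2) (e 1) = 0 := by rw [L.br_swap_left, hc2, neg_zero]
  intro x hxP y hyP z hzP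
  rw [hx x hxP, hx y hyP, hx z hzP]
  simp only [Fin.sum_univ_three, map_add, map_smul, LinearMap.add_apply, LinearMap.smul_apply,
    br_self_left, br_self_outer, br_self_right, hc, hc1, hc2, hc3, hc4, hc5, smul_zero, add_zero]

/-- Each `[p, q, ·]` scales `a` by its trace, so Filippov for `[a, u, [v, w, s]]` becomes the
Plücker relation: here the trace form has rank at most two. -/
theorem traceForm_plucker_of_span [FiniteDimensional F A] {a : A} (ha : a ≠ 0)
    (hspan : ∀ x y z, L.br x y z ∈ Submodule.span F {a}) (u v w s : A) :
    L.traceForm u v * L.traceForm w s - L.traceForm u w * L.traceForm v s +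
      L.traceForm u s * L.traceForm v w = 0 := by
  have h1 : ∀ p q, L.br p q a = L.traceForm p q • a := fun p q =>
    LinearMap.apply_eq_trace_smul (hspan p q)
  have h2 : ∀ p q, L.br a p q = L.traceForm p q • a := fun p q => by rw [L.br_rotate, h1]
  have h3 : ∀ p q, L.br p a q = -L.traceForm p q • a := fun p q => by
    rw [L.br_swap_left, h2, neg_smul]
  obtain ⟨c, hc⟩ := Submodule.mem_span_singleton.1 (hspan v w s)
  have h := L.br_filippov a u v w s
  rw [← hc, map_smul, br_self_outer, smul_zero, h2 u v, h2 u w, h2 u s] at h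
  simp only [map_smul, LinearMap.smul_apply, h1, h2, h3, smul_smul, ← add_smul] at h
  have h' := (smul_eq_zero.1 h.symm).resolve_right ha
  linear_combination h'

/-- In dimension at most five the trace form has rank at most two. -/
theorem traceForm_eq_zero_of_orthogonal [CharZero F] [FiniteDimensional F A]
    (hA : Module.finrank F A ≤ 5) {v w : A} (hvw : L.traceForm v w ≠ 0) {x : A}
    (hv : L.traceForm v x = 0) (hw : L.traceForm w x = 0) (y : A) : L.traceForm x y = 0 := by
  set τ := L.traceForm with hτ
  have hsw : ∀ p q, τ p q = - τ q p := L.traceForm_swap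
  have hself : ∀ p, τ p p = 0 := L.traceForm_self
  by_contra hne
  obtain ⟨y', hvy, hwy, hxy⟩ : ∃ y', τ v y' = 0 ∧ τ w y' = 0 ∧ τ x y' ≠ 0 := by
    -- Project `y` to the orthogonal complement of the plane of `v` and `w`.
    refine ⟨y - (τ v y / τ v w) • w + (τ w y / τ v w) • v, ?_, ?_, ?_⟩
    · simp [hself, hvw]
    · simp [hself, hsw w v, hvw]
    · simpa [hsw x v, hsw x w, hv, hw] using hne
  let Φ : A →ₗ[F] (Fin 4 → F) := LinearMap.pi ![τ v, τ w, τ x, τ y']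
  have hΦ : Function.Surjective Φ := fun c => by
    refine ⟨(c 0 / τ v w) • w - (c 1 / τ v w) • v + (c 2 / τ x y') • y' - (c 3 / τ x y') • x, ?_⟩
    ext i
    fin_cases i
    · simp [Φ, hself, hvw, hvy, hv]
    · simp [Φ, hself, hvw, hwy, hw, hsw w v]
    · simp [Φ, hself, hxy, hsw x v, hsw x w, hv, hw]
    · simp [Φ, hself, hxy, hsw y' v, hsw y' w, hvy, hwy, hsw y' x]
  -- Rank four would give four independent functionals killing the derived algebra, leaving it
  -- dimension at most one, where the Plücker relation applies.
  have hker : L.derived ≤ LinearMap.ker Φ := fun d hd => by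
    ext i
    fin_cases i <;> exact L.traceForm_of_mem_derived_right hd _
  have hdim := Φ.finrank_range_add_finrank_ker
  rw [LinearMap.range_eq_top.2 hΦ, finrank_top, Module.finrank_fin_fun] at hdim
  have hle := Submodule.finrank_mono hker
  obtain ⟨⟨a, ha1⟩, ha⟩ := finrank_le_one_iff.1 (show Module.finrank F L.derived ≤ 1 by omega)
  have hspan : ∀ p q r, L.br p q r ∈ Submodule.span F {a} := fun p q r => by
    obtain ⟨c, hc⟩ := ha ⟨_, L.br_mem_derived p q r⟩
    exact Submodule.mem_span_singleton.2 ⟨c, congrArg Subtype.val hc⟩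
  rcases eq_or_ne a 0 with rfl | ha0
  · have : L.br v w = 0 := by
      ext z
      simpa using hspan v w z
    exact hvw (by rw [hτ, traceForm_apply, this, map_zero])
  · have h := L.traceForm_plucker_of_span ha0 hspan x v w y'
    rw [← hτ, hsw x v, hsw x w, hv, hw] at h
    simp [hxy, hvw] at h

theorem exists_isCompatible_of_finrank_eq_four_of_derived_ne_top [CharZero F]
    (hA : Module.finrank F A = 4) (hder : L.derived ≠ ⊤) :
    ∃ P : ThreePreLieAlgebra F A, P.IsCompatible L := by
  have : FiniteDimensional F A := .of_finrank_pos (by omega)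
  obtain ⟨φ, hφ, hker, hiso⟩ : ∃ φ : A →ₗ[F] F, φ ≠ 0 ∧ L.derived ≤ LinearMap.ker φ ∧
      ∀ x ∈ LinearMap.ker φ, ∀ y ∈ LinearMap.ker φ, L.traceForm x y = 0 := by
    by_cases h : L.traceForm = 0
    · obtain ⟨φ, hφ, hle⟩ := L.derived.exists_le_ker_of_lt_top hder.lt_top
      exact ⟨φ, hφ, hle, by simp [h]⟩
    · obtain ⟨v, hv⟩ : ∃ v, L.traceForm v ≠ 0 := by
        by_contra! h'
        exact h (LinearMap.ext h')
      obtain ⟨w, hw⟩ : ∃ w, L.traceForm v w ≠ 0 := by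
        by_contra! h'
        exact hv (LinearMap.ext h')
      -- As the rank is two, the hyperplane orthogonal to `v` is the radical plus the line of `v`,
      -- hence isotropic.
      refine ⟨L.traceForm v, hv, fun d hd => L.traceForm_of_mem_derived_right hd v,
        fun x hx y hy => ?_⟩
      rw [LinearMap.mem_ker] at hx hy
      have := L.traceForm_eq_zero_of_orthogonal (by omega) hw
        (x := x + (L.traceForm w x / L.traceForm v w) • v) (by simp [hx])
        (by simp [L.traceForm_swap w v, hw]) y
      simpa [hy] using this
  have hdim : Module.finrank F (LinearMap.ker φ) = 3 := by
    have h := φ.finrank_range_add_finrank_ker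
    rw [LinearMap.range_eq_top.2 (LinearMap.surjective hφ), finrank_top, Module.finrank_self] at h
    omega
  have hab := L.br_eq_zero_of_isotropic hdim hker hiso
  exact L.exists_isCompatible_of_hyperplane hφ hker fun x y z hx hy hz => hab x hx y hy z hz

end ThreeLieAlgebra

/-! ### Dimension five with derived algebra of dimension at most three. -/

/-- Two symmetric matrices `a`, `b` such that `b K a` is antisymmetric for every antisymmetric
`K` are proportional. -/
theorem Matrix.exists_proportional_of_symm {F ι : Type*} [Field F] [CharZero F] {a b : ι → ι → F}
    (ha : ∀ i j, a i j = a j i) (hb : ∀ i j, b i j = b j i)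
    (h : ∀ i j k l, a i k * b j l + a i l * b j k = a j k * b i l + a j l * b i k) :
    ∃ α β : F, (α ≠ 0 ∨ β ≠ 0) ∧ ∀ i j, α * a i j + β * b i j = 0 := by
  have hm : ∀ i j k l, a i k * b j l = a j l * b i k := fun i j k l => by
    have h1 := h i j k l
    have h2 := h k j i l
    have h3 := h l j i k
    rw [ha k i, ha j i, hb j i, hb k i] at h2
    rw [ha l i, ha j i, ha l k, hb j i, hb l k, hb l i] at h3
    -- In `h1 + h2 - h3` all other products cancel by symmetry.
    have h4 : 2 * (a i k * b j l - a j l * b i k) = 0 := by linear_combination h1 + h2 - h3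
    exact sub_eq_zero.1 ((mul_eq_zero.1 h4).resolve_left two_ne_zero)
  by_cases h0 : ∀ i j, a i j = 0
  · exact ⟨1, 0, by simp, by simp [h0]⟩
  · push Not at h0
    obtain ⟨i, j, hij⟩ := h0
    refine ⟨b i j, -a i j, Or.inr (neg_ne_zero.2 hij), fun k l => ?_⟩
    linear_combination -hm i k j l

namespace ThreeLieAlgebra

variable {F A : Type*} [Field F] [AddCommGroup A] [Module F A] (L : ThreeLieAlgebra F A)

/-- For a three-dimensional subspace `P` between the derived algebra and the radical of the trace
form, the brackets `[x, y, v]` and `[x, y, w]` on `P` are proportional. -/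
theorem exists_smul_add_smul_br_eq_zero [CharZero F] [FiniteDimensional F A] {P : Submodule F A}
    (hP : Module.finrank F P = 3) (hder : L.derived ≤ P)
    (hrad : ∀ x ∈ P, ∀ y, L.traceForm x y = 0) (v w : A) :
    ∃ α β : F, (α ≠ 0 ∨ β ≠ 0) ∧ ∀ x ∈ P, ∀ y ∈ P, L.br x y (α • v + β • w) = 0 := by
  have hab := L.br_eq_zero_of_isotropic hP hder fun x hx y _ => hrad x hx y
  obtain ⟨e, ε, he, -, hx, htr⟩ := Submodule.exists_frame hP
  have hmem : ∀ x y z, L.br x y z ∈ P := fun x y z => hder (L.br_mem_derived x y z)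
  -- Cyclic pairs index a basis of the exterior square of `P`, so `f u` records `[·, ·, u]` on `P`
  -- as a 3 × 3 matrix.
  let f : A → Fin 3 → A := fun u => ![L.br (e 1) (e 2) u, L.br (e 2) (e 0) u, L.br (e 0) (e 1) u]
  have hf : ∀ u i, f u i ∈ P := fun u i => by
    fin_cases i <;> exact hmem _ _ _
  have h01 : ∀ u, L.br (e 0) (e 1) u = f u 2 := fun _ => rfl
  have h12 : ∀ u, L.br (e 1) (e 2) u = f u 0 := fun _ => rfl
  have h20 : ∀ u, L.br (e 2) (e 0) u = f u 1 := fun _ => rfl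
  have h10 : ∀ u, L.br (e 1) (e 0) u = - f u 2 := fun u => L.br_swap_left _ _ _
  have h21 : ∀ u, L.br (e 2) (e 1) u = - f u 0 := fun u => L.br_swap_left _ _ _
  have h02 : ∀ u, L.br (e 0) (e 2) u = - f u 1 := fun u => L.br_swap_left _ _ _
  -- The trace of `[e i, ·, u]` is, up to sign, an antisymmetric part of this matrix.
  have hsymm : ∀ u i j, ε j (f u i) = ε i (f u j) := by
    intro u
    have ht : ∀ i, ∑ j, ε j (L.br (e i) (e j) u) = 0 := fun i => by
      have h := hrad _ (he i) u
      rw [traceForm_apply, htr _ (hmem _ _)] at h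
      rw [← neg_eq_zero, ← h, ← Finset.sum_neg_distrib]
      refine Finset.sum_congr rfl fun j _ => ?_
      rw [L.br_swap_right (e i) u, map_neg]
    have t0 := ht 0
    have t1 := ht 1
    have t2 := ht 2
    simp only [Fin.sum_univ_three, h01, h12, h20, h10, h21, h02, br_self_left, map_zero,
      map_neg, zero_add, add_zero] at t0 t1 t2
    have s12 : ε 2 (f u 1) = ε 1 (f u 2) := by linear_combination -t0
    have s20 : ε 2 (f u 0) = ε 0 (f u 2) := by linear_combination t1
    have s01 : ε 1 (f u 0) = ε 0 (f u 1) := by linear_combination -t2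
    intro i j
    fin_cases i <;> fin_cases j <;>
      first | rfl | exact s12 | exact s20 | exact s01 | exact s12.symm | exact s20.symm |
        exact s01.symm
  -- Expand `[x, y, [z, v, w]]`: it and the `[x, y, z]` term vanish because `P` is abelian.
  have hcomm : ∀ x ∈ P, ∀ y ∈ P, ∀ z ∈ P, L.br z (L.br x y v) w = L.br z (L.br x y w) v := by
    intro x hxP y hyP z hzP
    have h := L.br_filippov x y z v w
    rw [hab x hxP y hyP _ (hmem _ _ _), hab x hxP y hyP z hzP, map_zero, LinearMap.zero_apply,
      LinearMap.zero_apply, zero_add, L.br_swap_right z v] at h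
    exact (sub_eq_zero.1 (by rw [h]; abel))
  have hz : ∀ z ∈ P, ∀ k, L.br z (f v k) w = L.br z (f w k) v := by
    intro z hzP k
    fin_cases k <;> exact hcomm _ (he _) _ (he _) z hzP
  have hexp : ∀ i k l u u', ε l (L.br (e i) (f u k) u') =
      ∑ s, ε s (f u k) * ε l (L.br (e i) (e s) u') := fun i k l u u' => by
    conv_lhs => rw [hx _ (hf u k)]
    simp [LinearMap.sum_apply]
  have hrel : ∀ i j k l,
      ε k (f v i) * ε l (f w j) + ε l (f v i) * ε k (f w j) =
        ε k (f v j) * ε l (f w i) + ε l (f v j) * ε k (f w i) := by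
    intro i j k l
    -- For distinct `i, j` in the goal, the instance of `g` at the third index is the required
    -- relation.
    have g : ∀ i, ∑ s, ε s (f v k) * ε l (L.br (e i) (e s) w) =
        ∑ s, ε s (f w k) * ε l (L.br (e i) (e s) v) := fun i => by
      rw [← hexp, ← hexp, hz _ (he i)]
    have g0 := g 0
    have g1 := g 1
    have g2 := g 2
    simp only [Fin.sum_univ_three, h01, h12, h20, h10, h21, h02, br_self_left, map_zero,
      map_neg, zero_add, add_zero, mul_zero, hsymm _ k] at g0 g1 g2
    fin_cases i <;> fin_cases j <;> simp only [Fin.zero_eta, Fin.mk_one, Fin.reduceFinMk] <;>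
      first | ring1 | linear_combination g0 | linear_combination g1 | linear_combination g2 |
        linear_combination -g0 | linear_combination -g1 | linear_combination -g2
  obtain ⟨α, β, hne, h⟩ := Matrix.exists_proportional_of_symm (a := fun i j => ε j (f v i))
    (b := fun i j => ε j (f w i)) (hsymm v) (hsymm w) hrel
  refine ⟨α, β, hne, ?_⟩
  have hzero : ∀ i, f (α • v + β • w) i = 0 := fun i => by
    have hlin : f (α • v + β • w) i = α • f v i + β • f w i := by
      fin_cases i <;> simp [f]
    rw [hx _ (hf _ i)]
    refine Finset.sum_eq_zero fun j _ => ?_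
    rw [hlin, map_add, map_smul, map_smul, smul_eq_mul, smul_eq_mul, h, zero_smul]
  intro x hxP y hyP
  generalize α • v + β • w = u at hzero ⊢
  rw [hx x hxP, hx y hyP]
  simp only [Fin.sum_univ_three, map_add, map_smul, LinearMap.add_apply, LinearMap.smul_apply,
    br_self_left, h01, h12, h20, h10, h21, h02, hzero, neg_zero, smul_zero, add_zero]

end ThreeLieAlgebra

namespace ThreeLieAlgebra

variable {F A : Type*} [Field F] [AddCommGroup A] [Module F A] (L : ThreeLieAlgebra F A)

/-- Functionals vanishing on the derived algebra whose common kernel lies in the radical of the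
trace form. -/
theorem exists_functionals_ker_le_radical [CharZero F] (hA : Module.finrank F A = 5)
    (hder : Module.finrank F L.derived ≤ 3) :
    ∃ (φ ψ : A →ₗ[F] F) (v w : A), φ v = 1 ∧ φ w = 0 ∧ ψ v = 0 ∧ ψ w = 1 ∧
      (∀ x ∈ L.derived, φ x = 0 ∧ ψ x = 0) ∧
      ∀ x, φ x = 0 → ψ x = 0 → ∀ y, L.traceForm x y = 0 := by
  have : FiniteDimensional F A := .of_finrank_pos (by omega)
  by_cases h : L.traceForm = 0
  · have hlt : ∀ S : Submodule F A, Module.finrank F S ≤ 4 → S < ⊤ := fun S hS => by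
      refine lt_top_iff_ne_top.2 ?_
      rintro rfl
      rw [finrank_top] at hS
      omega
    obtain ⟨φ, hφ, hφle⟩ := L.derived.exists_le_ker_of_lt_top (hlt _ (by omega))
    obtain ⟨v, hv⟩ := LinearMap.surjective hφ 1
    have hvd : v ∉ L.derived := fun hmem => by simpa [hv] using hφle hmem
    obtain ⟨ψ, hψ, hψle⟩ := (L.derived ⊔ Submodule.span F {v}).exists_le_ker_of_lt_top
      (hlt _ (by rw [Submodule.finrank_sup_span_singleton hvd]; omega))
    obtain ⟨w, hw⟩ := LinearMap.surjective hψ 1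
    have hψv : ψ v = 0 := hψle (Submodule.mem_sup_right (Submodule.mem_span_singleton_self v))
    exact ⟨φ, ψ, v, w - φ w • v, hv, by simp [hv], hψv, by simp [hψv, hw],
      fun x hx => ⟨hφle hx, hψle (Submodule.mem_sup_left hx)⟩, by simp [h]⟩
  · obtain ⟨v, w, hvw⟩ : ∃ v w, L.traceForm v w ≠ 0 := by
      by_contra! h'
      exact h (LinearMap.ext₂ h')
    -- Pairing with `w` and with `v`, normalised to be dual to `v, w`; as the rank is two, their
    -- common kernel is the radical.
    refine ⟨(L.traceForm v w)⁻¹ • L.traceForm.flip w, (L.traceForm v w)⁻¹ • L.traceForm v, v, w,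
      by simp [hvw], by simp, by simp, by simp [hvw], fun x hx => ?_, fun x hx hx' y => ?_⟩
    · simp [L.traceForm_of_mem_derived hx, L.traceForm_of_mem_derived_right hx]
    · refine L.traceForm_eq_zero_of_orthogonal hA.le hvw ?_ ?_ y
      · simpa [hvw] using hx'
      · rw [traceForm_swap, neg_eq_zero]
        simpa [hvw] using hx

theorem exists_isCompatible_of_finrank_eq_five_of_derived_le [CharZero F]
    (hA : Module.finrank F A = 5) (hder : Module.finrank F L.derived ≤ 3) :
    ∃ P : ThreePreLieAlgebra F A, P.IsCompatible L := by
  have : FiniteDimensional F A := .of_finrank_pos (by omega)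
  obtain ⟨φ, ψ, v, w, hφv, hφw, hψv, hψw, hd, hrad⟩ := L.exists_functionals_ker_le_radical hA hder
  let P := LinearMap.ker (φ.prod ψ)
  have hmem : ∀ x, x ∈ P ↔ φ x = 0 ∧ ψ x = 0 := fun x => by
    simp [P, LinearMap.ker_prod]
  have hP : Module.finrank F P = 3 := by
    have h := (φ.prod ψ).finrank_range_add_finrank_ker
    have hs : Function.Surjective (φ.prod ψ) := fun c =>
      ⟨c.1 • v + c.2 • w, by ext <;> simp [hφv, hφw, hψv, hψw]⟩
    rw [LinearMap.range_eq_top.2 hs, finrank_top, Module.finrank_prod, Module.finrank_self] at h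
    change Module.finrank F (LinearMap.ker (φ.prod ψ)) = 3
    omega
  have hPder : L.derived ≤ P := fun x hx => (hmem x).2 (hd x hx)
  have hPrad : ∀ x ∈ P, ∀ y, L.traceForm x y = 0 := fun x hx =>
    hrad x ((hmem x).1 hx).1 ((hmem x).1 hx).2
  obtain ⟨α, β, hne, hbr⟩ := L.exists_smul_add_smul_br_eq_zero hP hPder hPrad v w
  have hab := L.br_eq_zero_of_isotropic hP hPder fun x hx y _ => hPrad x hx y
  set u := α • v + β • w with hu
  have hφu : φ u = α := by simp [hu, hφv, hφw]
  have hψu : ψ u = β := by simp [hu, hψv, hψw]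
  -- The functional `β • φ - α • ψ` kills both `P` and `u`, so its kernel is `P` plus the line of
  -- `u`, the abelian hyperplane sought.
  have hdec : ∀ x, (β • φ - α • ψ) x = 0 → ∃ t : F, x - t • u ∈ P := fun x hx => by
    simp only [LinearMap.sub_apply, LinearMap.smul_apply, smul_eq_mul, sub_eq_zero] at hx
    rcases hne with hα | hβ
    · refine ⟨φ x / α, (hmem _).2 ⟨?_, ?_⟩⟩
      · simp [hφu, hα]
      · simp only [map_sub, map_smul, hψu, smul_eq_mul]
        field_simp
        linear_combination -hx
    · refine ⟨ψ x / β, (hmem _).2 ⟨?_, ?_⟩⟩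
      · simp only [map_sub, map_smul, hφu, smul_eq_mul]
        field_simp
        linear_combination hx
      · simp [hψu, hβ]
  refine L.exists_isCompatible_of_hyperplane (φ := β • φ - α • ψ) (fun h0 => ?_)
    (fun x hx => ?_) fun x y z hx hy hz => ?_
  · have h1 := LinearMap.congr_fun h0 v
    have h2 := LinearMap.congr_fun h0 w
    simp [hφv, hφw, hψv, hψw] at h1 h2
    tauto
  · simp [hd x hx]
  · obtain ⟨r, hr⟩ := hdec x hx
    obtain ⟨s, hs⟩ := hdec y hy
    obtain ⟨t, ht⟩ := hdec z hz
    have h1 := hab _ hr _ hs _ ht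
    have h2 := hbr _ hr _ hs
    have h3 := hbr _ hs _ ht
    have h4 := hbr _ ht _ hr
    rw [← L.br_rotate] at h3
    rw [L.br_rotate] at h4
    rw [← sub_add_cancel x (r • u), ← sub_add_cancel y (s • u), ← sub_add_cancel z (t • u)]
    generalize x - r • u = x at *
    generalize y - s • u = y at *
    generalize z - t • u = z at *
    simp only [map_add, map_smul, LinearMap.add_apply, LinearMap.smul_apply, h1, h2, h3, h4,
      br_self_left, br_self_right, br_self_outer, smul_zero, add_zero]

end ThreeLieAlgebra

/-! ### Four-dimensional derived algebras. -/

namespace ThreeLieAlgebra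

variable {F A : Type*} [Field F] [AddCommGroup A] [Module F A] (L : ThreeLieAlgebra F A)

theorem br_mem_of_lt {n : ℕ} {e : Fin n → A} {S : Submodule F A}
    (h : ∀ i j k, i < j → j < k → L.br (e i) (e j) (e k) ∈ S) (a b c : Fin n → F) :
    L.br (∑ i, a i • e i) (∑ i, b i • e i) (∑ i, c i • e i) ∈ S := by
  have hl : ∀ x y z, L.br x y z ∈ S → L.br y x z ∈ S := fun x y z hx => by
    rw [br_swap_left]; exact S.neg_mem hx
  have hr : ∀ x y z, L.br x y z ∈ S → L.br x z y ∈ S := fun x y z hx => by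
    rw [br_swap_right]; exact S.neg_mem hx
  have hall : ∀ i j k, L.br (e i) (e j) (e k) ∈ S := by
    intro i j k
    rcases lt_trichotomy i j with hij | rfl | hij
    · rcases lt_trichotomy j k with hjk | rfl | hjk
      · exact h i j k hij hjk
      · simp
      · rcases lt_trichotomy i k with hik | rfl | hik
        · exact hr _ _ _ (h i k j hik hjk)
        · simp
        · exact hr _ _ _ (hl _ _ _ (h k i j hik hij))
    · simp
    · rcases lt_trichotomy i k with hik | rfl | hik
      · exact hl _ _ _ (h j i k hij hik)
      · simp
      · rcases lt_trichotomy j k with hjk | rfl | hjk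
        · exact hl _ _ _ (hr _ _ _ (h j k i hjk hik))
        · simp
        · exact hl _ _ _ (hr _ _ _ (hl _ _ _ (h k j i hjk hij)))
  simp only [map_sum, map_smul, LinearMap.sum_apply, LinearMap.smul_apply]
  exact S.sum_mem fun i _ => S.smul_mem _ (S.sum_mem fun j _ => S.smul_mem _
    (S.sum_mem fun k _ => S.smul_mem _ (hall _ _ _)))

/-- If the derived algebra is four-dimensional and all brackets are brackets of its elements, then
some derivation acts injectively on it and is a sum of inner derivations. -/
theorem exists_derivation_injOn_derived [FiniteDimensional F A]
    (hder : Module.finrank F L.derived = 4)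
    (h : ∀ x y z, ∃ x' ∈ L.derived, ∃ y' ∈ L.derived, ∃ z' ∈ L.derived,
      L.br x y z = L.br x' y' z') :
    ∃ a b c d : A, ∀ x ∈ L.derived, (L.br a b + L.br c d) x = 0 → x = 0 := by
  obtain ⟨e, ε, he, -, hx, -⟩ := Submodule.exists_frame hder
  refine ⟨e 0, e 1, e 2, e 3, ?_⟩
  set D := L.br (e 0) (e 1) + L.br (e 2) (e 3) with hD
  -- `D` sends `e 0, e 1, e 2, e 3` to the brackets of the triples `023, 123, 012, 013`: every
  -- triple occurs once, so `D` maps onto the derived algebra.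
  have hlt : ∀ i j k, i < j → j < k → L.br (e i) (e j) (e k) ∈ L.derived.map D := by
    have hDe : ∀ i, D (e i) ∈ L.derived.map D := fun i => Submodule.mem_map_of_mem (he i)
    have h0 := hDe 0
    have h1 := hDe 1
    have h2 := hDe 2
    have h3 := hDe 3
    simp only [hD, LinearMap.add_apply, br_self_outer, br_self_right, zero_add,
      add_zero] at h0 h1 h2 h3
    rw [← L.br_rotate] at h0 h1
    intro i j k hij hjk
    fin_cases i <;> fin_cases j <;> fin_cases k <;>
      first | exact absurd hij (by decide) | exact absurd hjk (by decide) | exact h0 | exact h1 |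
        exact h2 | exact h3
  have hle : L.derived ≤ L.derived.map D := L.derived_le fun x y z => by
    obtain ⟨x', hx', y', hy', z', hz', heq⟩ := h x y z
    rw [heq, hx x' hx', hx y' hy', hx z' hz']
    exact L.br_mem_of_lt hlt _ _ _
  have hmaps : ∀ x ∈ L.derived, D x ∈ L.derived := fun x _ =>
    add_mem (L.br_mem_derived _ _ _) (L.br_mem_derived _ _ _)
  have hsurj : Function.Surjective (D.restrict hmaps) := fun y => by
    obtain ⟨x, hx, hxy⟩ := hle y.2
    exact ⟨⟨x, hx⟩, Subtype.ext hxy⟩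
  have hinj := LinearMap.injective_iff_surjective.2 hsurj
  intro x hx h0
  exact congrArg Subtype.val (@hinj ⟨x, hx⟩ 0 (Subtype.ext (by simpa using h0)))

theorem exists_isCompatible_of_derived_eq_top (hA : Module.finrank F A = 4)
    (hder : L.derived = ⊤) : ∃ P : ThreePreLieAlgebra F A, P.IsCompatible L := by
  have : FiniteDimensional F A := .of_finrank_pos (by omega)
  obtain ⟨a, b, c, d, hD⟩ := L.exists_derivation_injOn_derived (by rw [hder, finrank_top, hA])
    fun x y z => ⟨x, by simp [hder], y, by simp [hder], z, by simp [hder], rfl⟩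
  refine L.exists_isCompatible_of_injective ((L.isDerivation_br a b).add (L.isDerivation_br c d)) ?_
  rw [injective_iff_map_eq_zero]
  exact fun x hx => hD x (by simp [hder]) hx

theorem br_of_mem_center {z : A} (hz : z ∈ L.center) (x y : A) :
    L.br z x y = 0 ∧ L.br x z y = 0 ∧ L.br x y z = 0 := by
  have h : ∀ x y, L.br z x y = 0 := hz
  exact ⟨h x y, by rw [br_swap_left, h, neg_zero], by rw [← br_rotate, h]⟩

theorem br_add_smul_center {z : A} (hz : z ∈ L.center) (x y w : A) (r s t : F) :
    L.br (x + r • z) (y + s • z) (w + t • z) = L.br x y w := by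
  have h1 := fun x y => (L.br_of_mem_center hz x y).1
  have h2 := fun x y => (L.br_of_mem_center hz x y).2.1
  have h3 := fun x y => (L.br_of_mem_center hz x y).2.2
  simp only [map_add, map_smul, LinearMap.add_apply, LinearMap.smul_apply, h1, h2, h3, smul_zero,
    add_zero]

/-- Here `A` is the derived algebra plus the line of `z`, so elements of the derived algebra already
give all brackets. The inner part is injective there, and the projection to the central line, also a
derivation, supplies the missing direction. -/
theorem exists_isCompatible_of_center_not_le_derived (hA : Module.finrank F A = 5)
    (hder : Module.finrank F L.derived = 4) {z : A} (hz : z ∈ L.center) (hzd : z ∉ L.derived) :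
    ∃ P : ThreePreLieAlgebra F A, P.IsCompatible L := by
  have : FiniteDimensional F A := .of_finrank_pos (by omega)
  obtain ⟨φ₀, hφ₀, hker₀⟩ := Submodule.exists_le_ker_of_notMem hzd
  obtain ⟨φ, hφz, hker⟩ : ∃ φ : A →ₗ[F] F, φ z = 1 ∧ L.derived ≤ LinearMap.ker φ :=
    ⟨(φ₀ z)⁻¹ • φ₀, by simp [hφ₀], fun x hx => by
      have : φ₀ x = 0 := hker₀ hx
      simp [this]⟩
  have hdim := φ.finrank_range_add_finrank_ker
  rw [LinearMap.range_eq_top.2 (LinearMap.surjective (by rintro rfl; simp at hφz)), finrank_top,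
    Module.finrank_self] at hdim
  have hkereq := Submodule.eq_of_le_of_finrank_eq hker (by omega)
  have hmem : ∀ x, x - φ x • z ∈ L.derived := fun x => by
    rw [hkereq, LinearMap.mem_ker]
    simp [hφz]
  obtain ⟨a, b, c, d, hD⟩ := L.exists_derivation_injOn_derived hder fun x y w =>
    ⟨_, hmem x, _, hmem y, _, hmem w, by
      conv_lhs => rw [← sub_add_cancel x (φ x • z), ← sub_add_cancel y (φ y • z),
        ← sub_add_cancel w (φ w • z)]
      rw [L.br_add_smul_center hz]⟩
  have hE : L.IsDerivation (φ.smulRight z) := fun x y w => by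
    have h0 : φ (L.br x y w) = 0 := hker (L.br_mem_derived x y w)
    simp [h0, L.br_of_mem_center hz]
  refine L.exists_isCompatible_of_injective
    (((L.isDerivation_br a b).add (L.isDerivation_br c d)).add hE) ?_
  rw [injective_iff_map_eq_zero]
  intro x hx
  have h1 : φ (L.br a b x) = 0 := hker (L.br_mem_derived _ _ _)
  have h2 : φ (L.br c d x) = 0 := hker (L.br_mem_derived _ _ _)
  have hφx : φ x = 0 := by
    have h := congrArg φ hx
    simpa [h1, h2, hφz] using h
  refine hD x (by rw [hkereq]; exact hφx) ?_
  simpa [hφx] using hx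

/-- Modulo `z` the derived algebra is three-dimensional, and vanishing traces force its brackets
into the line of `z`. Brackets with a complementary vector `v` span a complement `S` of that line.
Weights `1` on `S`, `3` on `z` and `-1` on `v` modulo `z` then fit: `1 + 1 + 1 = 3` and `1 + 1 - 1 =
1`. -/
theorem exists_isCompatible_of_center_inf_derived [CharZero F] (hA : Module.finrank F A = 5)
    (hder : Module.finrank F L.derived = 4) {z : A} (hz : z ∈ L.center) (hz0 : z ≠ 0)
    (hzd : z ∈ L.derived) : ∃ P : ThreePreLieAlgebra F A, P.IsCompatible L := by
  have : FiniteDimensional F A := .of_finrank_pos (by omega)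
  have hlt : L.derived < ⊤ := lt_top_iff_ne_top.2 fun h => by
    rw [h, finrank_top] at hder
    omega
  obtain ⟨φ, hφ, hφker⟩ := L.derived.exists_le_ker_of_lt_top hlt
  obtain ⟨v, hv⟩ := LinearMap.surjective hφ 1
  have hφz : φ z = 0 := hφker hzd
  have hkereq : L.derived = LinearMap.ker φ := by
    have hdim := φ.finrank_range_add_finrank_ker
    rw [LinearMap.range_eq_top.2 (LinearMap.surjective hφ), finrank_top,
      Module.finrank_self] at hdim
    exact Submodule.eq_of_le_of_finrank_eq hφker (by omega)
  obtain ⟨χ, hχ⟩ : ∃ χ : A →ₗ[F] F, χ z = 1 := by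
    obtain ⟨f, hf, -⟩ := Submodule.exists_le_ker_of_notMem
      (show z ∉ (⊥ : Submodule F A) by simpa using hz0)
    exact ⟨(f z)⁻¹ • f, by simp [hf]⟩
  -- a complement of the central line in the derived algebra
  let J := LinearMap.ker (φ.prod χ)
  have hJmem : ∀ x, x ∈ J ↔ φ x = 0 ∧ χ x = 0 := fun x => by simp [J, LinearMap.ker_prod]
  have hJ : Module.finrank F J = 3 := by
    have h := (φ.prod χ).finrank_range_add_finrank_ker
    have hs : Function.Surjective (φ.prod χ) := fun c =>
      ⟨c.1 • v + (c.2 - c.1 * χ v) • z, by ext <;> simp [hv, hφz, hχ]⟩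
    rw [LinearMap.range_eq_top.2 hs, finrank_top, Module.finrank_prod, Module.finrank_self] at h
    change Module.finrank F (LinearMap.ker (φ.prod χ)) = 3
    omega
  have hJd : ∀ x ∈ L.derived, x - χ x • z ∈ J := fun x hx => by
    have : φ x = 0 := hφker hx
    simp [hJmem, this, hφz, hχ]
  obtain ⟨e, ε, he, -, hx, htr⟩ := Submodule.exists_frame hJ
  have hed : ∀ i, e i ∈ L.derived := fun i => by
    rw [hkereq]
    exact ((hJmem _).1 (he i)).1
  have hred : ∀ x ∈ L.derived, ∃ a : Fin 3 → F, x = ∑ i, a i • e i + χ x • z := fun x hxd => by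
    refine ⟨fun i => ε i (x - χ x • z), ?_⟩
    rw [← hx _ (hJd x hxd), sub_add_cancel]
  -- the derived algebra has central brackets
  have htrace : ∀ i j, ∑ k, ε k (L.br (e i) (e j) (e k) - χ (L.br (e i) (e j) (e k)) • z) = 0 := by
    intro i j
    let g : A →ₗ[F] A := (χ ∘ₗ L.br (e i) (e j)).smulRight z
    -- `g` has range in the line of `z` and kills the central `z`, so removing it moves the range
    -- into `J` without changing the trace.
    have hg : LinearMap.trace F A g = 0 := by
      have h := LinearMap.apply_eq_trace_smul (f := g) (a := z) fun x =>
        Submodule.smul_mem _ _ (Submodule.mem_span_singleton_self z)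
      have hgz : g z = 0 := by simp [g, L.br_of_mem_center hz]
      rw [hgz] at h
      exact (smul_eq_zero.1 h.symm).resolve_right hz0
    have h := htr (L.br (e i) (e j) - g) fun x => hJd _ (L.br_mem_derived _ _ _)
    rw [map_sub, hg, sub_zero, ← traceForm_apply, L.traceForm_of_mem_derived (hed i)] at h
    exact h.symm
  have hc : L.br (e 0) (e 1) (e 2) ∈ Submodule.span F {z} := by
    have h2 := htrace 0 1
    have h0 := htrace 1 2
    have h1 := htrace 2 0
    simp only [Fin.sum_univ_three, br_self_outer, br_self_right, map_zero, zero_smul, sub_zero,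
      zero_add, add_zero] at h0 h1 h2
    rw [← L.br_rotate] at h0
    rw [L.br_rotate] at h1
    have hsub := hx _ (hJd _ (L.br_mem_derived (e 0) (e 1) (e 2)))
    rw [Fin.sum_univ_three, h0, h1, h2] at hsub
    simp only [zero_smul, add_zero, sub_eq_zero] at hsub
    rw [hsub]
    exact Submodule.smul_mem _ _ (Submodule.mem_span_singleton_self z)
  have hcen : ∀ x ∈ L.derived, ∀ y ∈ L.derived, ∀ w ∈ L.derived,
      L.br x y w ∈ Submodule.span F {z} := by
    intro x hxd y hyd w hwd
    obtain ⟨a, ha⟩ := hred x hxd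
    obtain ⟨b, hb⟩ := hred y hyd
    obtain ⟨c, hc'⟩ := hred w hwd
    rw [ha, hb, hc', L.br_add_smul_center hz]
    refine L.br_mem_of_lt (fun i j k hij hjk => ?_) _ _ _
    fin_cases i <;> fin_cases j <;> fin_cases k <;>
      first | exact absurd hij (by decide) | exact absurd hjk (by decide) | exact hc
  -- the brackets with `v` span a hyperplane of the derived algebra avoiding the center
  let S := Submodule.span F (Set.range ![L.br (e 1) (e 2) v, L.br (e 2) (e 0) v,
    L.br (e 0) (e 1) v])
  have hSdim : Module.finrank F S ≤ 3 := (finrank_range_le_card _).trans (by simp)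
  have hS : ∀ x ∈ L.derived, ∀ y ∈ L.derived, L.br x y v ∈ S := by
    have h0 : L.br (e 1) (e 2) v ∈ S := Submodule.subset_span ⟨0, rfl⟩
    have h1 : L.br (e 2) (e 0) v ∈ S := Submodule.subset_span ⟨1, rfl⟩
    have h2 : L.br (e 0) (e 1) v ∈ S := Submodule.subset_span ⟨2, rfl⟩
    have hneg : ∀ i j, L.br (e i) (e j) v ∈ S → L.br (e j) (e i) v ∈ S := fun i j h => by
      rw [br_swap_left]; exact S.neg_mem h
    have hij : ∀ i j, L.br (e i) (e j) v ∈ S := by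
      intro i j
      fin_cases i <;> fin_cases j <;>
        first | exact h0 | exact h1 | exact h2 | exact hneg _ _ h0 | exact hneg _ _ h1 |
          exact hneg _ _ h2 | simp
    intro x hxd y hyd
    obtain ⟨a, ha⟩ := hred x hxd
    obtain ⟨b, hb⟩ := hred y hyd
    have h := L.br_add_smul_center hz (∑ i, a i • e i) (∑ i, b i • e i) v (χ x) (χ y) 0
    rw [← ha, ← hb, zero_smul, add_zero] at h
    rw [h]
    simp only [map_sum, map_smul, LinearMap.sum_apply, LinearMap.smul_apply]
    exact S.sum_mem fun i _ => S.smul_mem _ (S.sum_mem fun j _ => S.smul_mem _ (hij _ _))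
  have hproj : ∀ x, x - φ x • v ∈ L.derived := fun x => by
    rw [hkereq, LinearMap.mem_ker]
    simp [hv]
  have hSv : ∀ x y, L.br x y v ∈ S := fun x y => by
    have h := hS _ (hproj x) _ (hproj y)
    simpa using h
  have hmix : ∀ x y w, φ x • L.br v y w + φ y • L.br x v w + φ w • L.br x y v ∈ S :=
    fun x y w => by
      refine add_mem (add_mem (S.smul_mem _ ?_) (S.smul_mem _ ?_)) (S.smul_mem _ (hSv x y))
      · rw [br_rotate]; exact hSv _ _
      · rw [br_swap_right]; exact S.neg_mem (hSv _ _)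
  have hdec : ∀ x y w, L.br x y w - (φ x • L.br v y w + φ y • L.br x v w + φ w • L.br x y v) ∈
      Submodule.span F {z} := fun x y w => by
    rw [← br_sub_sub_sub]
    exact hcen _ (hproj x) _ (hproj y) _ (hproj w)
  -- Otherwise the four-dimensional derived algebra would lie in `S`, which is spanned by three
  -- vectors.
  have hzS : z ∉ S := fun hzS => by
    have hle : L.derived ≤ S := L.derived_le fun x y w => by
      have h := add_mem ((Submodule.span_singleton_le_iff_mem z S).2 hzS (hdec x y w)) (hmix x y w)
      rwa [sub_add_cancel] at h
    have := Submodule.finrank_mono hle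
    omega
  obtain ⟨ζ, hζz, hζS⟩ : ∃ ζ : A →ₗ[F] F, ζ z = 1 ∧ ∀ x ∈ S, ζ x = 0 := by
    obtain ⟨f, hf, hfS⟩ := Submodule.exists_le_ker_of_notMem hzS
    exact ⟨(f z)⁻¹ • f, by simp [hf], fun x hx => by
      have : f x = 0 := hfS hx
      simp [this]⟩
  let D : A →ₗ[F] A := LinearMap.id - (2 : F) • φ.smulRight v + (2 : F) • ζ.smulRight z
  have hDx : ∀ x, D x = x - (2 : F) • φ x • v + (2 : F) • ζ x • z := fun x => by simp [D]
  refine L.exists_isCompatible_of_injective (D := D) (fun x y w => ?_) ?_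
  · have h0 : φ (L.br x y w) = 0 := hφker (L.br_mem_derived x y w)
    obtain ⟨c, hc⟩ := Submodule.mem_span_singleton.1 (hdec x y w)
    have hζ : ζ (L.br x y w) = c := by
      have h := congrArg ζ hc
      rw [map_sub, hζS _ (hmix x y w), map_smul, hζz, sub_zero, smul_eq_mul, mul_one] at h
      exact h.symm
    simp only [hDx, map_add, map_sub, map_smul, LinearMap.add_apply, LinearMap.sub_apply,
      LinearMap.smul_apply, h0, hζ, L.br_of_mem_center hz, zero_smul, smul_zero, sub_zero,
      add_zero]
    rw [hc]
    module
  · rw [injective_iff_map_eq_zero]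
    intro x hx
    rw [hDx] at hx
    have hφx : φ x = 0 := by
      have h := congrArg φ hx
      simp only [map_add, map_sub, map_smul, hv, hφz, smul_eq_mul, map_zero] at h
      linear_combination -h
    have hζx : ζ x = 0 := by
      have h := congrArg ζ hx
      simp only [map_add, map_smul, hφx, hζz, smul_eq_mul, map_zero, zero_smul, smul_zero,
        sub_zero] at h
      linear_combination (1 / 3 : F) * h
    simpa [hφx, hζx] using hx

end ThreeLieAlgebra

theorem theorem2p5 {F A : Type*} [Field F] [IsAlgClosed F] [CharZero F]
    [AddCommGroup A] [Module F A] (L : ThreeLieAlgebra F A) :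
    (Module.finrank F A = 4 → ∃ P : ThreePreLieAlgebra F A, P.IsCompatible L) ∧
    (Module.finrank F A = 5 →
      (Module.finrank F L.derived ≤ 3 ∨
        (Module.finrank F L.derived = 4 ∧ L.center ≠ ⊥)) →
      ∃ P : ThreePreLieAlgebra F A, P.IsCompatible L) := by
  refine ⟨fun hA => ?_, fun hA h => ?_⟩
  · by_cases hder : L.derived = ⊤
    · exact L.exists_isCompatible_of_derived_eq_top hA hder
    · exact L.exists_isCompatible_of_finrank_eq_four_of_derived_ne_top hA hder
  · rcases h with hle | ⟨hder, hcen⟩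
    · exact L.exists_isCompatible_of_finrank_eq_five_of_derived_le hA hle
    · obtain ⟨z, hz, hz0⟩ := (Submodule.ne_bot_iff _).1 hcen
      by_cases hzd : z ∈ L.derived
      · exact L.exists_isCompatible_of_center_inf_derived hA hder hz hz0 hzd
      · exact L.exists_isCompatible_of_center_not_le_derived hA hder hz hzd
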